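/- Let $\mathbb K\in\{\mathbb R,\mathbb C\}$, let $G$ be a Hausdorff locally convex space over $\mathbb K$ with topological dual $G'$, and let $M$ be an oriented smooth manifold (Hausdorff, second countable), with or without boundary, of dimension $N\ge 1$. Let $\mathcal A(M)$ be the algebra of smooth functions $M\to\mathbb R$ and $\Gamma(TM)$ the $\mathcal A(M)$-module of smooth vector fields. Let $\mathfrak L^1_c(M,G,\lambda)$ be the $\mathcal A(M)$-module of compactly supported maps $f:M\to G$ such that for every chart $(U,\phi)$ and every $\psi\in G'$ the function $\psi\circ f\circ\phi^{-1}$ is Lebesgue integrable near every point of $\phi(U)$ (equivalently: every point of $M$ lies in the domain of a chart $\phi$ for which all $\psi\circ f\circ\phi^{-1}$, $\psi\in G'$, are integrable). Let $\mathrm{Alt}^N(M)$ be the module of alternating $\mathcal A(M)$-multilinear maps $\Gamma(TM)^N\to\mathcal A(M)$, and let $\mathrm{Alt}^N(M;G,\lambda)=\mathfrak L^1_c(M,G,\lambda)\otimes_{\mathcal A(M)}\mathrm{Alt}^N(M)$ be the module of $G$-valued scalarly essentially integrable maximal forms. A form $\eta=\sum_j f_j\otimes T_j$ has at $p\in M$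 the value $\sum_j f_j(p)\otimes (T_j)_p\in G\otimes_{\mathbb R}\mathrm{Alt}^N(T_pM)$, and $\mathrm{supp}(\eta)$ is the closure of the set of points where this value is nonzero. For $\psi\in G'$ put $\psi_\times(f\otimes T)=(\psi\circ f)\otimes T$. An oriented chart is a chart that is positively or negatively oriented; put $\gamma_\phi=1$ in the first case and $\gamma_\phi=-1$ otherwise. For a real-valued $\omega\in\mathrm{Alt}^N(M;\mathbb R,\lambda)$ define $\int\omega=\sum_{\alpha\in D}\gamma_{\phi_\alpha}\int_{\phi_\alpha(U_\alpha)}(\phi_\alpha^{-1})^{*}(\psi_\alpha\omega)$, for any finite family of oriented charts $(U_\alpha,\phi_\alpha)_{\alpha\in D}$ covering $\mathrm{supp}(\omega)$ and any smooth partition of unity $\{\psi_\alpha\}_{\alpha\in D\cup\{\dagger\}}$ subordinate to $\{U_\alpha\}_{\alpha\in D}$ and $U_\dagger=M\setminus\mathrm{supp}(\omega)$; this does not depend on the choices. For $\mathbb K=\mathbb C$ and $\beta\in\mathrm{Alt}^N(M;\mathbb C,\lambda)$ put $\int\beta=\int\mathrm{Re}\,\beta+i\int\mathrm{Im}\,\beta$.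 The weak integral of $\eta\in\mathrm{Alt}^N(M;G,\lambda)$ is the map $\int\eta:G'\to\mathbb K$, $\psi\mapsto\int\psi_\times(\eta)$. **Statement.** Let $\eta\in\mathrm{Alt}^N(M;G,\lambda)$, let $\{(U_\alpha,\phi_\alpha)\}_{\alpha\in D}$ be a finite family of oriented charts of $M$ such that $\{U_\alpha\}_{\alpha\in D}$ covers $\mathrm{supp}(\eta)$, put $U_\dagger=M\setminus\mathrm{supp}(\eta)$, and let $\{\psi_\alpha\}_{\alpha\in D\cup\{\dagger\}}$ be a smooth partition of unity on $M$ subordinate to $\{U_\alpha\}_{\alpha\in D\cup\{\dagger\}}$. Then $\int\eta$ is an element of the algebraic dual $(G')^{*}$, i.e. it is $\mathbb K$-linear on $G'$, and $$\int\eta=\sum_{\alpha\in D}\int\psi_\alpha\cdot\eta .$$ -/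

import Mathlib

open Set MeasureTheory Topology
open scoped Manifold ContDiff TensorProduct Bundle

noncomputable section

namespace VectorForms

variable {n : ℕ} {H : Type*} [TopologicalSpace H]

/-- The algebra `𝒜(M)` of smooth real functions on `M`. -/
abbrev SmoothFun (I : ModelWithCorners ℝ (EuclideanSpace ℝ (Fin n)) H)
    (M : Type*) [TopologicalSpace M] [ChartedSpace H M] : Type _ :=
  C^∞⟮I, M; 𝓘(ℝ), ℝ⟯

/-- The smooth vector fields `Γ(TM)` on `M`. -/
abbrev VectorField (I : ModelWithCorners ℝ (EuclideanSpace ℝ (Fin n)) H)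
    (M : Type*) [TopologicalSpace M] [ChartedSpace H M] [IsManifold I ∞ M] : Type _ :=
  Cₛ^∞⟮I; EuclideanSpace ℝ (Fin n), (TangentSpace I : M → Type _)⟯

section Fields

variable {I : ModelWithCorners ℝ (EuclideanSpace ℝ (Fin n)) H}
  {M : Type*} [TopologicalSpace M] [ChartedSpace H M] [IsManifold I ∞ M]

instance : SMul (SmoothFun I M) (VectorField I M) :=
  ⟨fun g X => ⟨(g : M → ℝ) • (X : ∀ p, TangentSpace I p),
    ContMDiff.smul_section g.contMDiff X.contMDiff⟩⟩

theorem smul_field_apply (g : SmoothFun I M) (X : VectorField I M) (p : M) :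
    (g • X) p = g p • X p := rfl

/-- `Γ(TM)` is an `𝒜(M)`-module for pointwise multiplication. -/
instance : Module (SmoothFun I M) (VectorField I M) where
  smul_add g X Y := by ext1 p; exact smul_add (g p) (X p) (Y p)
  add_smul g h X := by ext1 p; exact add_smul (g p) (h p) (X p)
  mul_smul g h X := by ext1 p; exact mul_smul (g p) (h p) (X p)
  one_smul X := by ext1 p; exact one_smul ℝ (X p)
  zero_smul X := by ext1 p; exact zero_smul ℝ (X p)
  smul_zero g := by ext1 p; exact smul_zero (g p)

instance : IsScalarTower ℝ (SmoothFun I M) (VectorField I M) where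
  smul_assoc c g X := by ext1 p; exact smul_assoc c (g p) (X p)

/-- Evaluation of vector fields at a point. -/
def evalField (p : M) : VectorField I M →ₗ[ℝ] TangentSpace I p where
  toFun X := X p
  map_add' _ _ := rfl
  map_smul' _ _ := rfl

/-- Evaluation of smooth functions at a point. -/
def evalFun (p : M) : SmoothFun I M →ₗ[ℝ] ℝ where
  toFun g := g p
  map_add' _ _ := rfl
  map_smul' _ _ := rfl

/-- Every tangent vector is the value of a smooth vector field. -/
theorem evalField_surjective [T2Space M] (p : M) :
    Function.Surjective (evalField (I := I) p) := by
  intro v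
  obtain ⟨s, hs, hX⟩ := FiberBundle.exists_contMDiffOn_extend (k := ∞) I (EuclideanSpace ℝ (Fin n)) v
  obtain ⟨f, -, hf⟩ := (SmoothBumpFunction.nhds_basis_tsupport (I := I) p).mem_iff.1
    (interior_mem_nhds.2 hs)
  refine ⟨⟨_, ContMDiffOn.smul_section_of_tsupport (ψ := (f : M → ℝ)) f.contMDiff.contMDiffOn
    isOpen_interior hf (hX.mono interior_subset)⟩, ?_⟩
  change f p • FiberBundle.extend (EuclideanSpace ℝ (Fin n)) v p = v
  simp

/-- A linear choice of vector fields with prescribed value at `p`. -/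
def extendField [T2Space M] (p : M) : TangentSpace I p →ₗ[ℝ] VectorField I M :=
  ((evalField (I := I) p).exists_rightInverse_of_surjective
    (LinearMap.range_eq_top.2 (evalField_surjective p))).choose

theorem extendField_apply_self [T2Space M] (p : M) (v : TangentSpace I p) :
    extendField p v p = v :=
  LinearMap.congr_fun ((evalField (I := I) p).exists_rightInverse_of_surjective
    (LinearMap.range_eq_top.2 (evalField_surjective p))).choose_spec v

end Fields

/-- `Alt^N(M)`, `N = dim M`: the alternating `𝒜(M)`-multilinear maps `Γ(TM)^N → 𝒜(M)`. -/
abbrev SmoothForm (I : ModelWithCorners ℝ (EuclideanSpace ℝ (Fin n)) H)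
    (M : Type*) [TopologicalSpace M] [ChartedSpace H M] [IsManifold I ∞ M] : Type _ :=
  (VectorField I M) [⋀^Fin n]→ₗ[SmoothFun I M] (SmoothFun I M)

/-- The value at `p` of the differential form attached to `T ∈ Alt^N(M)`:
`(v₁, …, v_N) ↦ T(X₁, …, X_N)(p)` where `X_i` are smooth vector fields with `X_i(p) = v_i`
(by `𝒜(M)`-multilinearity the choice of the `X_i` is immaterial). -/
def SmoothForm.valueAt {I : ModelWithCorners ℝ (EuclideanSpace ℝ (Fin n)) H}
    {M : Type*} [TopologicalSpace M] [ChartedSpace H M] [IsManifold I ∞ M] [T2Space M]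
    (T : SmoothForm I M) (p : M) : (TangentSpace I p) [⋀^Fin n]→ₗ[ℝ] ℝ :=
  ((evalFun p).compAlternatingMap
    ({ T.toMultilinearMap.restrictScalars ℝ with
        map_eq_zero_of_eq' := fun v _ _ h hij => T.map_eq_zero_of_eq v h hij } :
      (VectorField I M) [⋀^Fin n]→ₗ[ℝ] (SmoothFun I M))).compLinearMap (extendField p)

theorem SmoothForm.valueAt_apply {I : ModelWithCorners ℝ (EuclideanSpace ℝ (Fin n)) H}
    {M : Type*} [TopologicalSpace M] [ChartedSpace H M] [IsManifold I ∞ M] [T2Space M]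
    (T : SmoothForm I M) (p : M) (v : Fin n → TangentSpace I p) :
    T.valueAt p v = T (fun i => extendField p (v i)) p := rfl

section IntegrableMaps

variable (𝕜 : Type*) [RCLike 𝕜] (I : ModelWithCorners ℝ (EuclideanSpace ℝ (Fin n)) H)
  (M : Type*) [TopologicalSpace M] [ChartedSpace H M]

/-- `f : M → G` is scalarly essentially Lebesgue integrable in charts: for every smooth chart
`φ : U → ℝ^N` of `M` and every `ψ ∈ G'`, the function `ψ ∘ f ∘ φ⁻¹` is integrable near every point
of `φ(U)` for the Lebesgue measure. By the change of variables formula this holds as soon as every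
point of `M` lies in the domain of one chart `φ` for which all `ψ ∘ f ∘ φ⁻¹` are integrable. (The
integrability over all of `φ(U)` cannot be asked of every chart: it depends on the chart.) -/
def IsScalarlyIntegrable {M : Type*} [TopologicalSpace M] [ChartedSpace H M]
    {G : Type*} [AddCommGroup G] [Module 𝕜 G] [TopologicalSpace G] (f : M → G) : Prop :=
  ∀ e ∈ IsManifold.maximalAtlas I ∞ M, ∀ ψ : G →L[𝕜] 𝕜,
    LocallyIntegrableOn (fun y => ψ (f ((e.extend I).symm y))) (e.extend I).target volume

variable (G : Type*) [AddCommGroup G] [Module 𝕜 G] [Module ℝ G] [IsScalarTower ℝ 𝕜 G]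
  [TopologicalSpace G]

/-- `𝔏¹_c(M, G, λ)`: the compactly supported scalarly integrable maps `M → G`. -/
def IntegrableMap : AddSubgroup (M → G) where
  carrier := {f | HasCompactSupport f ∧ IsScalarlyIntegrable 𝕜 I f}
  zero_mem' := by
    refine ⟨HasCompactSupport.zero, fun e he ψ => ?_⟩
    simpa using locallyIntegrableOn_zero
  add_mem' := by
    rintro f g ⟨hf, hf'⟩ ⟨hg, hg'⟩
    refine ⟨hf.add hg, fun e he ψ => ?_⟩
    simpa using! (hf' e he ψ).add (hg' e he ψ)
  neg_mem' := by
    rintro f ⟨hf, hf'⟩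
    refine ⟨hf.neg, fun e he ψ => ?_⟩
    have h : (fun y => ψ ((-f) ((e.extend I).symm y))) =
        -fun y => ψ (f ((e.extend I).symm y)) := by ext y; simp
    rw [h]
    exact (hf' e he ψ).neg

end IntegrableMaps

section Module

theorem isLocallyClosed_extend_target {I : ModelWithCorners ℝ (EuclideanSpace ℝ (Fin n)) H}
    {M : Type*} [TopologicalSpace M] (e : OpenPartialHomeomorph M H) :
    IsLocallyClosed (e.extend I).target := by
  rw [e.extend_target]
  exact ((e.open_target.preimage I.continuous_symm).isLocallyClosed).inter
    I.isClosed_range.isLocallyClosed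

variable {𝕜 : Type*} [RCLike 𝕜] {I : ModelWithCorners ℝ (EuclideanSpace ℝ (Fin n)) H}
  {M : Type*} [TopologicalSpace M] [ChartedSpace H M]
  {G : Type*} [AddCommGroup G] [Module 𝕜 G] [Module ℝ G] [IsScalarTower ℝ 𝕜 G]
  [TopologicalSpace G]

instance : SMul (SmoothFun I M) (IntegrableMap 𝕜 I M G) :=
  ⟨fun g f => ⟨fun p => g p • (f : M → G) p, by
    refine ⟨f.2.1.mono fun p hp h => hp (by simp [h]), fun e he ψ => ?_⟩
    have hc : ContinuousOn (fun y => g ((e.extend I).symm y)) (e.extend I).target :=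
      g.contMDiff.continuous.comp_continuousOn e.continuousOn_extend_symm
    have h : (fun y => ψ (g ((e.extend I).symm y) • (f : M → G) ((e.extend I).symm y))) =
        fun y => g ((e.extend I).symm y) • ψ ((f : M → G) ((e.extend I).symm y)) := by
      ext y
      exact (ψ : G →ₗ[𝕜] 𝕜).map_smul_of_tower _ _
    rw [h]
    exact (f.2.2 e he ψ).continuousOn_smul (isLocallyClosed_extend_target e) hc⟩⟩

theorem smul_map_apply (g : SmoothFun I M) (f : IntegrableMap 𝕜 I M G) (p : M) :
    (g • f : IntegrableMap 𝕜 I M G).1 p = g p • f.1 p := rfl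

/-- `𝔏¹_c(M, G, λ)` is an `𝒜(M)`-module for pointwise multiplication. -/
instance : Module (SmoothFun I M) (IntegrableMap 𝕜 I M G) where
  smul_add g X Y := by ext p; exact smul_add (g p) (X.1 p) (Y.1 p)
  add_smul g h X := by ext p; exact add_smul (g p) (h p) (X.1 p)
  mul_smul g h X := by ext p; exact mul_smul (g p) (h p) (X.1 p)
  one_smul X := by ext p; exact one_smul ℝ (X.1 p)
  zero_smul X := by ext p; exact zero_smul ℝ (X.1 p)
  smul_zero g := by ext p; exact smul_zero (g p)

/-- Composition of integrable maps with a real-linear map `F : G → G₁` that preserves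
integrability, as an `𝒜(M)`-linear map. -/
def IntegrableMap.comp {𝕜₁ : Type*} [RCLike 𝕜₁]
    {G₁ : Type*} [AddCommGroup G₁] [Module 𝕜₁ G₁] [Module ℝ G₁] [IsScalarTower ℝ 𝕜₁ G₁]
    [TopologicalSpace G₁] (F : G →ₗ[ℝ] G₁)
    (hF : ∀ f : M → G, IsScalarlyIntegrable 𝕜 I f → IsScalarlyIntegrable 𝕜₁ I (fun p => F (f p))) :
    IntegrableMap 𝕜 I M G →ₗ[SmoothFun I M] IntegrableMap 𝕜₁ I M G₁ where
  toFun f := ⟨fun p => F (f.1 p), f.2.1.comp_left (map_zero F), hF _ f.2.2⟩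
  map_add' f g := by ext p; exact map_add F (f.1 p) (g.1 p)
  map_smul' g f := by ext p; exact map_smul F (g p) (f.1 p)

/-- `ψ_* f = ψ ∘ f` for `ψ ∈ ℒ(G, G₁)`. -/
def IntegrableMap.push {G₁ : Type*} [AddCommGroup G₁] [Module 𝕜 G₁] [Module ℝ G₁]
    [IsScalarTower ℝ 𝕜 G₁] [TopologicalSpace G₁] (ψ : G →L[𝕜] G₁) :
    IntegrableMap 𝕜 I M G →ₗ[SmoothFun I M] IntegrableMap 𝕜 I M G₁ :=
  IntegrableMap.comp ((ψ : G →ₗ[𝕜] G₁).restrictScalars ℝ)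
    fun _ hf e he χ => hf e he (χ.comp ψ)

/-- The real part of a scalar integrable map. -/
def IntegrableMap.re : IntegrableMap 𝕜 I M 𝕜 →ₗ[SmoothFun I M] IntegrableMap ℝ I M ℝ :=
  IntegrableMap.comp (RCLike.reCLM : 𝕜 →L[ℝ] ℝ).toLinearMap fun _ hf e he χ =>
    (χ.comp (RCLike.reCLM : 𝕜 →L[ℝ] ℝ)).locallyIntegrableOn_comp
      (hf e he (ContinuousLinearMap.id 𝕜 𝕜))

/-- The imaginary part of a scalar integrable map. -/
def IntegrableMap.im : IntegrableMap 𝕜 I M 𝕜 →ₗ[SmoothFun I M] IntegrableMap ℝ I M ℝ :=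
  IntegrableMap.comp (RCLike.imCLM : 𝕜 →L[ℝ] ℝ).toLinearMap fun _ hf e he χ =>
    (χ.comp (RCLike.imCLM : 𝕜 →L[ℝ] ℝ)).locallyIntegrableOn_comp
      (hf e he (ContinuousLinearMap.id 𝕜 𝕜))

end Module

section Forms

/-- `Alt^N(M; G, λ) = 𝔏¹_c(M, G, λ) ⊗_{𝒜(M)} Alt^N(M)`, `N = dim M`: the `G`-valued scalarly
essentially integrable maximal forms on `M`. -/
abbrev IntegrableForm (𝕜 : Type*) [RCLike 𝕜]
    (I : ModelWithCorners ℝ (EuclideanSpace ℝ (Fin n)) H)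
    (M : Type*) [TopologicalSpace M] [ChartedSpace H M] [IsManifold I ∞ M]
    (G : Type*) [AddCommGroup G] [Module 𝕜 G] [Module ℝ G] [IsScalarTower ℝ 𝕜 G]
    [TopologicalSpace G] : Type _ :=
  IntegrableMap 𝕜 I M G ⊗[SmoothFun I M] SmoothForm I M

variable {𝕜 : Type*} [RCLike 𝕜] {I : ModelWithCorners ℝ (EuclideanSpace ℝ (Fin n)) H}
  {M : Type*} [TopologicalSpace M] [ChartedSpace H M] [IsManifold I ∞ M]
  {G : Type*} [AddCommGroup G] [Module 𝕜 G] [Module ℝ G] [IsScalarTower ℝ 𝕜 G]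
  [TopologicalSpace G]

namespace IntegrableForm

/-- The pushforward `ψ_× = ψ_* ⊗ Id` of forms by `ψ ∈ ℒ(G, G₁)`. -/
def push {G₁ : Type*} [AddCommGroup G₁] [Module 𝕜 G₁] [Module ℝ G₁]
    [IsScalarTower ℝ 𝕜 G₁] [TopologicalSpace G₁] (ψ : G →L[𝕜] G₁) :
    IntegrableForm 𝕜 I M G →ₗ[SmoothFun I M] IntegrableForm 𝕜 I M G₁ :=
  TensorProduct.map (IntegrableMap.push ψ) LinearMap.id

/-- The real part of a scalar form. -/
def re : IntegrableForm 𝕜 I M 𝕜 →ₗ[SmoothFun I M] IntegrableForm ℝ I M ℝ :=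
  TensorProduct.map IntegrableMap.re LinearMap.id

/-- The imaginary part of a scalar form. -/
def im : IntegrableForm 𝕜 I M 𝕜 →ₗ[SmoothFun I M] IntegrableForm ℝ I M ℝ :=
  TensorProduct.map IntegrableMap.im LinearMap.id

variable [T2Space M]

/-- The value at `p` of a `G`-valued form, as an alternating map on `T_pM` with values in `G`:
for `η = f ⊗ T` it is `(v₁, …, v_N) ↦ T_p(v₁, …, v_N) • f(p)`. This is `f(p) ⊗ T_p` under
`G ⊗_ℝ Alt^N(T_pM) ≅ Alt^N(T_pM; G)`. -/
def valueAt (η : IntegrableForm 𝕜 I M G) (p : M) : (TangentSpace I p) [⋀^Fin n]→ₗ[ℝ] G :=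
  TensorProduct.liftAddHom
    { toFun := fun f =>
        { toFun := fun T => (LinearMap.toSpanSingleton ℝ G (f.1 p)).compAlternatingMap (T.valueAt p)
          map_zero' := by ext v; simp [SmoothForm.valueAt_apply]
          map_add' := fun S T => by ext v; simp [SmoothForm.valueAt_apply, add_smul] }
      map_zero' := by ext T v; simp
      map_add' := fun f g => by ext T v; simp }
    (fun g f T => by
      ext v
      simp [SmoothForm.valueAt_apply, smul_map_apply, smul_smul, mul_comm]) η

theorem valueAt_tmul (f : IntegrableMap 𝕜 I M G) (T : SmoothForm I M) (p : M)
    (v : Fin n → TangentSpace I p) :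
    IntegrableForm.valueAt (f ⊗ₜ T : IntegrableForm 𝕜 I M G) p v = T.valueAt p v • f.1 p := rfl

theorem valueAt_zero (p : M) : IntegrableForm.valueAt (0 : IntegrableForm 𝕜 I M G) p = 0 := rfl

theorem valueAt_add (η θ : IntegrableForm 𝕜 I M G) (p : M) :
    IntegrableForm.valueAt (η + θ) p = IntegrableForm.valueAt η p + IntegrableForm.valueAt θ p :=
  map_add (TensorProduct.liftAddHom _ _) η θ

/-- The support of a form: the closure of the set of points where its value is nonzero. -/
def support (η : IntegrableForm 𝕜 I M G) : Set M := closure {p | IntegrableForm.valueAt η p ≠ 0}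

theorem isCompact_support (η : IntegrableForm 𝕜 I M G) : IsCompact (support η) := by
  suffices h : ∃ K : Set M, IsCompact K ∧ ∀ p ∉ K, IntegrableForm.valueAt η p = 0 by
    obtain ⟨K, hK, h⟩ := h
    refine hK.of_isClosed_subset isClosed_closure (closure_minimal (fun p hp => ?_) hK.isClosed)
    exact by_contra fun hpK => hp (h p hpK)
  induction η using TensorProduct.induction_on with
  | zero => exact ⟨∅, isCompact_empty, fun p _ => valueAt_zero p⟩
  | tmul f T =>
    refine ⟨tsupport f.1, f.2.1, fun p hp => ?_⟩
    ext v
    rw [valueAt_tmul, image_eq_zero_of_notMem_tsupport hp]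
    simp
  | add η θ hη hθ =>
    obtain ⟨K, hK, h⟩ := hη
    obtain ⟨L, hL, h'⟩ := hθ
    refine ⟨K ∪ L, hK.union hL, fun p hp => ?_⟩
    rw [valueAt_add, h p (fun h => hp (Or.inl h)), h' p (fun h => hp (Or.inr h)), add_zero]

end IntegrableForm

end Forms

section Orientation

variable {I : ModelWithCorners ℝ (EuclideanSpace ℝ (Fin n)) H}
  {M : Type*} [TopologicalSpace M] [ChartedSpace H M]

/-- The coordinate frame `(∂/∂x₁, …, ∂/∂x_N)` of the chart `φ = e.extend I` at the point
`φ⁻¹(y)`, i.e. the image of the standard basis under the derivative of `φ⁻¹` at `y`. -/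
def chartFrame (e : OpenPartialHomeomorph M H) (y : EuclideanSpace ℝ (Fin n)) :
    Fin n → TangentSpace I ((e.extend I).symm y) :=
  fun i => mfderivWithin 𝓘(ℝ, EuclideanSpace ℝ (Fin n)) I (e.extend I).symm (range I) y
    (EuclideanSpace.single i (1 : ℝ))

/-- The coordinate frame of the chart `e` is everywhere positive for the family `o` of orientations
of the tangent spaces. -/
def IsPositiveChart (o : ∀ p : M, Orientation ℝ (TangentSpace I p) (Fin n))
    (e : OpenPartialHomeomorph M H) : Prop :=
  ∀ y ∈ (e.extend I).target,
    ∃ b : Module.Basis (Fin n) ℝ (TangentSpace I ((e.extend I).symm y)),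
      ⇑b = chartFrame e y ∧ b.orientation = o ((e.extend I).symm y)

variable (I M) in
/-- An orientation of `M`: an orientation of every tangent space such that every point lies in the
domain of a smooth chart whose coordinate frame is everywhere positive or everywhere negative. -/
structure ManifoldOrientation where
  orient : ∀ p : M, Orientation ℝ (TangentSpace I p) (Fin n)
  exists_chart : ∀ p : M, ∃ e ∈ IsManifold.maximalAtlas I ∞ M, p ∈ e.source ∧
    (IsPositiveChart orient e ∨ IsPositiveChart (fun q => -orient q) e)

namespace ManifoldOrientation

/-- The chart `e` is positively oriented. -/
def IsPositive (o : ManifoldOrientation I M) (e : OpenPartialHomeomorph M H) : Prop :=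
  IsPositiveChart o.orient e

/-- The chart `e` is negatively oriented. -/
def IsNegative (o : ManifoldOrientation I M) (e : OpenPartialHomeomorph M H) : Prop :=
  IsPositiveChart (fun q => -o.orient q) e

/-- A smooth chart of `M` that is positively or negatively oriented. -/
def IsOrientedChart (o : ManifoldOrientation I M) (e : OpenPartialHomeomorph M H) : Prop :=
  e ∈ IsManifold.maximalAtlas I ∞ M ∧ (o.IsPositive e ∨ o.IsNegative e)

open Classical in
/-- The sign `γ_φ` of an oriented chart. -/
def chartSign (o : ManifoldOrientation I M) (e : OpenPartialHomeomorph M H) : ℝ :=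
  if o.IsPositive e then 1 else -1

/-- The data used to integrate a form with support `S`: a finite family of oriented charts
`(U_α, φ_α)`, `α ∈ D`, covering `S`, and a smooth partition of unity on `M` indexed by
`D ∪ {†}` (here `† = none`) and subordinate to the sets `U_α` and `U_† = M ∖ S`. -/
structure IsAdapted (o : ManifoldOrientation I M) (S : Set M) {D : Type*} [Finite D]
    (e : D → OpenPartialHomeomorph M H) (ρ : SmoothPartitionOfUnity (Option D) I M) : Prop where
  oriented : ∀ α, o.IsOrientedChart (e α)
  covers : S ⊆ ⋃ α, (e α).source
  subordinate : ρ.IsSubordinate fun a => a.elim Sᶜ fun α => (e α).source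

/-- Adapted charts and partitions of unity exist for every compact set. -/
theorem exists_isAdapted [T2Space M] [SecondCountableTopology M] [IsManifold I ∞ M]
    (o : ManifoldOrientation I M) {S : Set M} (hS : IsCompact S) :
    ∃ (k : ℕ) (e : Fin k → OpenPartialHomeomorph M H)
      (ρ : SmoothPartitionOfUnity (Option (Fin k)) I M), o.IsAdapted S e ρ := by
  have : LocallyCompactSpace H := I.locallyCompactSpace
  have : LocallyCompactSpace M := ChartedSpace.locallyCompactSpace H M
  choose c hc hpc ho using o.exists_chart
  obtain ⟨t, -, ht⟩ := hS.elim_nhds_subcover (fun p => (c p).source)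
    fun p _ => (c p).open_source.mem_nhds (hpc p)
  let u : Fin t.card → M := fun i => (t.equivFin.symm i : M)
  have hcov : S ⊆ ⋃ i, (c (u i)).source := by
    intro p hp
    obtain ⟨q, hq, hpq⟩ := mem_iUnion₂.1 (ht hp)
    exact mem_iUnion.2 ⟨t.equivFin ⟨q, hq⟩, by simpa [u] using hpq⟩
  obtain ⟨ρ, hρ⟩ := SmoothPartitionOfUnity.exists_isSubordinate I isClosed_univ
    (fun a : Option (Fin t.card) => a.elim Sᶜ fun i => (c (u i)).source)
    (by
      rintro (_ | i)
      · exact hS.isClosed.isOpen_compl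
      · exact (c (u i)).open_source)
    (by
      intro p _
      by_cases hp : p ∈ S
      · obtain ⟨i, hi⟩ := mem_iUnion.1 (hcov hp)
        exact mem_iUnion.2 ⟨some i, hi⟩
      · exact mem_iUnion.2 ⟨none, hp⟩)
  exact ⟨t.card, fun i => c (u i), ρ, fun i => ⟨hc _, ho _⟩, hcov, hρ⟩

end ManifoldOrientation

end Orientation

section Integral

variable {𝕜 : Type*} [RCLike 𝕜] {I : ModelWithCorners ℝ (EuclideanSpace ℝ (Fin n)) H}
  {M : Type*} [TopologicalSpace M] [ChartedSpace H M] [IsManifold I ∞ M] [T2Space M]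
  {G : Type*} [AddCommGroup G] [Module 𝕜 G] [Module ℝ G] [IsScalarTower ℝ 𝕜 G]
  [TopologicalSpace G]

/-- The integral over `φ(U) ⊆ ℝ^N` of the pullback of `β` by `φ⁻¹`: writing this pullback as
`f dx₁ ∧ … ∧ dx_N`, i.e. `f(y) = β_{φ⁻¹(y)}(∂₁, …, ∂_N)`, it is the Lebesgue integral of `f`. -/
def chartIntegral (e : OpenPartialHomeomorph M H) (β : IntegrableForm ℝ I M ℝ) : ℝ :=
  ∫ y in (e.extend I).target, IntegrableForm.valueAt β ((e.extend I).symm y) (chartFrame e y)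

variable [SecondCountableTopology M]

/-- The integral of a real-valued maximal form: `∑_α γ_{φ_α} ∫ (φ_α⁻¹)^×(ψ_α β)` for a finite
family of oriented charts covering the support of `ω` and a subordinate partition of unity. -/
def realIntegral (o : ManifoldOrientation I M) (β : IntegrableForm ℝ I M ℝ) : ℝ :=
  let h := o.exists_isAdapted (IntegrableForm.isCompact_support β)
  let e := h.choose_spec.choose
  let ρ := h.choose_spec.choose_spec.choose
  ∑ α, o.chartSign (e α) * chartIntegral (e α) ((ρ (some α) : SmoothFun I M) • β)

/-- The integral of a scalar-valued maximal form, `∫ β = ∫ Re β + i ∫ Im β`. -/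
def scalarIntegral (o : ManifoldOrientation I M) (β : IntegrableForm 𝕜 I M 𝕜) : 𝕜 :=
  (realIntegral o (IntegrableForm.re β) : 𝕜) +
    (RCLike.I : 𝕜) * (realIntegral o (IntegrableForm.im β) : 𝕜)

/-- The weak integral of a `G`-valued maximal form, as a function on `G'`:
`(∫ η)(ψ) = ∫ ψ_×(η)`. -/
def weakIntegral (o : ManifoldOrientation I M) (η : IntegrableForm 𝕜 I M G) :
    (G →L[𝕜] 𝕜) → 𝕜 :=
  fun ψ => scalarIntegral o (IntegrableForm.push ψ η)

end Integral

end VectorForms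

end

/-! The integral of a real form depends only on its pointwise values, and depends linearly on them:
if `β = ∑ c_i θ_i` holds at every point on every frame, the same relation holds between the
integrals (`realIntegral_eq_sum`, and from it `scalarIntegral_eq_sum` and `scalarIntegral_eq_smul`).
All the claims are then pointwise identities. Since `(ψ_×η)_p = ψ ∘ η_p`, linearity in `ψ` is
immediate. Since the `ρ_α`, `α ∈ D`, sum to 1 on `supp η`, the forms `ρ_α η` add up pointwise to
`η`, and `ψ` commutes with finite sums.

The definition of the integral picks its own charts and partition for each form, so additivity is
not visible in it. It follows from independence of the choices (`adaptedSum_eq`): any data adapted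
to a set containing the support give the same number, so finitely many forms can be integrated with
data adapted to the union of their supports, where only additivity of the Lebesgue integral is left.
Independence itself is the usual double sum over two partitions, reduced to a form supported in the
overlap of two oriented charts. There the change of variables produces the absolute Jacobian, the
components of the form produce the Jacobian, and the chart signs account for the difference.

Integrability of the pieces also has to be proved: coefficients of smooth forms in charts are
continuous, which rests on tensoriality, and a cutoff leaves a compact set on which local
integrability suffices. -/

namespace VectorForms

/-! ### Tensoriality: algebraic forms have well-defined pointwise values. -/

section Tensoriality

variable {n : ℕ} {H : Type*} [TopologicalSpace H]
  {I : ModelWithCorners ℝ (EuclideanSpace ℝ (Fin n)) H}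
  {M : Type*} [TopologicalSpace M] [ChartedSpace H M] [IsManifold I ∞ M] [T2Space M]

/-- The product of a bump function with the local frame induced by a chart, as smooth vector
fields on `M`. -/
noncomputable def bumpFrame {p : M} (χ : SmoothBumpFunction I p) (i : Fin n) : VectorField I M :=
  ⟨(χ : M → ℝ) • (trivializationAt (EuclideanSpace ℝ (Fin n)) (TangentSpace I) p).localFrame
      (EuclideanSpace.basisFun (Fin n) ℝ).toBasis i,
    ContMDiffOn.smul_section_of_tsupport (u := (chartAt H p).source) χ.contMDiff.contMDiffOn
      (chartAt H p).open_source χ.tsupport_subset_chartAt_source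
      ((trivializationAt (EuclideanSpace ℝ (Fin n)) (TangentSpace I) p).contMDiffOn_localFrame_baseSet
        ∞ _ i)⟩

/-- The product of a bump function with a coefficient of a vector field in the local frame induced
by a chart, as a smooth function on `M`. -/
noncomputable def bumpCoeff {p : M} (χ : SmoothBumpFunction I p) (X : VectorField I M) (i : Fin n) :
    SmoothFun I M :=
  ⟨fun q => χ q • (trivializationAt (EuclideanSpace ℝ (Fin n)) (TangentSpace I) p).localFrameCoeff I
      (EuclideanSpace.basisFun (Fin n) ℝ).toBasis i q (X q),
    χ.contMDiff_smul (contMDiffOn_baseSet_localFrameCoeff (k := ∞)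
      (e := trivializationAt (EuclideanSpace ℝ (Fin n)) (TangentSpace I) p) _
      X.contMDiff.contMDiffOn i)⟩

/-- The square of a bump function, as a smooth function on `M`. -/
noncomputable def bumpSq {p : M} (χ : SmoothBumpFunction I p) : SmoothFun I M :=
  ⟨fun q => χ q * χ q, χ.contMDiff.mul χ.contMDiff⟩

/-- The expansion of `X` in a local frame, made global. Coefficients and frame each need a cutoff to
extend smoothly to `M`, hence the square of `χ`; outside the chart domain both sides vanish. -/
theorem sum_bumpCoeff_smul_bumpFrame {p : M} (χ : SmoothBumpFunction I p) (X : VectorField I M) :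
    ∑ i, bumpCoeff χ X i • bumpFrame χ i =
      bumpSq χ • X := by
  ext1 q
  have hsum : (∑ i, bumpCoeff χ X i • bumpFrame χ i) q =
      ∑ i, bumpCoeff χ X i q • bumpFrame χ i q := map_sum (evalField q) _ _
  rw [hsum, smul_field_apply]
  by_cases hq : q ∈ (chartAt H p).source
  · have := (trivializationAt (EuclideanSpace ℝ (Fin n)) (TangentSpace I) p).eq_sum_localFrameCoeff_smul
      (I := I) (b := (EuclideanSpace.basisFun (Fin n) ℝ).toBasis) (s := X) (x' := q) hq
    conv_rhs => rw [this, Finset.smul_sum]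
    refine Finset.sum_congr rfl fun i _ => ?_
    have h1 : ∀ (a b : ℝ) (v : TangentSpace I q), (a * b) • a • v = (a * a) • b • v :=
      fun a b v => by rw [smul_smul, smul_smul, mul_right_comm]
    exact h1 _ _ _
  · have h0 : χ q = 0 := by
      by_contra h
      exact hq (χ.tsupport_subset_chartAt_source (subset_tsupport _ h))
    have h1 : ∀ i, bumpCoeff χ X i q = 0 := fun i => by simp [bumpCoeff, h0]
    simp [h0, h1, bumpSq]

theorem bumpCoeff_apply_self_of_apply_eq_zero {p : M} (χ : SmoothBumpFunction I p)
    {X : VectorField I M} (hX : X p = 0) (i : Fin n) : bumpCoeff χ X i p = 0 := by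
  simp [bumpCoeff, hX]

/-- A form vanishes at `p` on vector fields one of which vanishes at `p`. -/
theorem SmoothForm.apply_eq_zero (T : SmoothForm I M) {p : M} {X : Fin n → VectorField I M}
    {i : Fin n} (hX : X i p = 0) : T X p = 0 := by
  let χ : SmoothBumpFunction I p := Classical.arbitrary _
  -- Evaluate `T` at `p` with `χ² X_i` in slot `i`. Linearity pulls out `χ(p)² = 1` on one side and
  -- the coefficients of `X_i`, which vanish at `p`, on the other.
  have h := congrArg (fun Y => T (Function.update X i Y) p) (sum_bumpCoeff_smul_bumpFrame χ (X i))
  simp only [AlternatingMap.map_update_smul, Function.update_eq_self, smul_eq_mul,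
    AlternatingMap.map_update_sum, ContMDiffMap.coe_mul, Pi.mul_apply] at h
  have hsum : ∀ g : Fin n → SmoothFun I M, (∑ j, g j) p = ∑ j, g j p :=
    fun g => map_sum (evalFun p) _ _
  rw [hsum] at h
  simp only [ContMDiffMap.coe_mul, Pi.mul_apply,
    bumpCoeff_apply_self_of_apply_eq_zero χ hX, zero_mul, Finset.sum_const_zero] at h
  have h1 : bumpSq χ p = 1 := by
    change χ p * χ p = 1
    simp
  rw [h1, one_mul] at h
  exact h.symm

/-- The value at `p` of a form on vector fields depends only on their values at `p`. -/
theorem SmoothForm.valueAt_apply_field (T : SmoothForm I M) (p : M)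
    (X : Fin n → VectorField I M) : T.valueAt p (fun i => X i p) = T X p := by
  classical
  rw [SmoothForm.valueAt_apply]
  set Y : Fin n → VectorField I M := fun i => extendField p (X i p)
  have hXY : ∀ i, (X - Y) i p = 0 := fun i => by
    change X i p - Y i p = 0
    rw [sub_eq_zero]
    exact (extendField_apply_self p (X i p)).symm
  -- Expand `T (Y + (X - Y))` over subsets of the slots: every term other than the one with `Y` in
  -- all slots contains a field vanishing at `p`.
  have h := T.toMultilinearMap.map_add_univ Y (X - Y)
  rw [add_sub_cancel] at h
  have h' := congrArg (evalFun p) h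
  rw [map_sum, Finset.sum_eq_single Finset.univ] at h'
  · simpa [evalFun] using! h'.symm
  · intro s _ hs
    obtain ⟨i, hi⟩ : ∃ i, i ∉ s := by simpa [Finset.eq_univ_iff_forall] using hs
    refine T.apply_eq_zero (i := i) ?_
    rw [Finset.piecewise_eq_of_notMem _ _ _ hi]
    exact hXY i
  · simp

end Tensoriality

/-! ### Coordinate changes, Jacobians and coefficients of forms in charts. -/

section CoordinateChange

variable {n : ℕ} {H : Type*} [TopologicalSpace H]
  {I : ModelWithCorners ℝ (EuclideanSpace ℝ (Fin n)) H}
  {M : Type*} [TopologicalSpace M]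

theorem extend_target_eq_image (e : OpenPartialHomeomorph M H) :
    (e.extend I).target = I '' e.target := by
  rw [e.extend_target, I.image_eq]

theorem measurableSet_extend_target (e : OpenPartialHomeomorph M H) :
    MeasurableSet (e.extend I).target :=
  have ⟨_, _, hU, hZ, h⟩ := isLocallyClosed_extend_target (I := I) e
  h ▸ hU.measurableSet.inter hZ.measurableSet

theorem measurableSet_extendCoordChange_source (e e' : OpenPartialHomeomorph M H) :
    MeasurableSet (I.extendCoordChange e e').source := by
  rw [I.extendCoordChange_source, I.image_eq]
  exact ((OpenPartialHomeomorph.open_source _).preimage I.continuous_symm).measurableSet.inter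
    I.isClosed_range.measurableSet

theorem mem_extendCoordChange_source {e e' : OpenPartialHomeomorph M H}
    {y : EuclideanSpace ℝ (Fin n)} : y ∈ (I.extendCoordChange e e').source ↔
      y ∈ (e.extend I).target ∧ (e.extend I).symm y ∈ e'.source := by
  rw [PartialEquiv.trans_source, PartialEquiv.symm_source, e'.extend_source]
  rfl

theorem extend_symm_extendCoordChange {e e' : OpenPartialHomeomorph M H}
    {y : EuclideanSpace ℝ (Fin n)} (hy : y ∈ (I.extendCoordChange e e').source) :
    (e'.extend I).symm (I.extendCoordChange e e' y) = (e.extend I).symm y :=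
  (e'.extend I).left_inv (by
    rw [e'.extend_source]
    exact (mem_extendCoordChange_source.1 hy).2)

/-- The derivative of a coordinate change. -/
noncomputable def coordChangeDeriv (I : ModelWithCorners ℝ (EuclideanSpace ℝ (Fin n)) H)
    (e e' : OpenPartialHomeomorph M H) (y : EuclideanSpace ℝ (Fin n)) :
    EuclideanSpace ℝ (Fin n) →L[ℝ] EuclideanSpace ℝ (Fin n) :=
  fderivWithin ℝ (I.extendCoordChange e e') (I.extendCoordChange e e').source y

variable [ChartedSpace H M] {e e' : OpenPartialHomeomorph M H}

theorem hasFDerivWithinAt_extendCoordChange (he : e ∈ IsManifold.maximalAtlas I ∞ M)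
    (he' : e' ∈ IsManifold.maximalAtlas I ∞ M) {y : EuclideanSpace ℝ (Fin n)}
    (hy : y ∈ (I.extendCoordChange e e').source) :
    HasFDerivWithinAt (I.extendCoordChange e e') (coordChangeDeriv I e e' y)
      (I.extendCoordChange e e').source y :=
  ((I.contDiffOn_extendCoordChange he he').differentiableOn (by simp) y hy).hasFDerivWithinAt

theorem continuousOn_coordChangeDeriv (he : e ∈ IsManifold.maximalAtlas I ∞ M)
    (he' : e' ∈ IsManifold.maximalAtlas I ∞ M) :
    ContinuousOn (coordChangeDeriv I e e') (I.extendCoordChange e e').source :=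
  (I.contDiffOn_extendCoordChange he he').continuousOn_fderivWithin
    I.uniqueDiffOn_extendCoordChange_source (by simp)

theorem hasMFDerivWithinAt_extend_symm (he : e ∈ IsManifold.maximalAtlas I ∞ M)
    {y : EuclideanSpace ℝ (Fin n)} (hy : y ∈ (e.extend I).target) :
    HasMFDerivWithinAt 𝓘(ℝ, EuclideanSpace ℝ (Fin n)) I (e.extend I).symm (range I) y
      (mfderivWithin 𝓘(ℝ, EuclideanSpace ℝ (Fin n)) I (e.extend I).symm (range I) y) := by
  refine MDifferentiableWithinAt.hasMFDerivWithinAt ?_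
  have h := (contMDiffOn_extend_symm he).mdifferentiableOn (by simp) y
    (by rwa [← extend_target_eq_image])
  refine h.mono_of_mem_nhdsWithin ?_
  rw [← extend_target_eq_image]
  have := e.extend_target_mem_nhdsWithin (I := I) (e.extend_source (I := I) ▸
    (e.extend I).map_target hy : (e.extend I).symm y ∈ e.source)
  rwa [(e.extend I).right_inv hy] at this

/-- The chain rule for `φ⁻¹ = φ'⁻¹ ∘ (φ' ∘ φ⁻¹)` on the overlap. Derivatives are taken within sets
because of a possible boundary; the overlap has unique derivatives, so the two expressions agree. -/
theorem mfderivWithin_extend_symm_eq_comp (he : e ∈ IsManifold.maximalAtlas I ∞ M)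
    (he' : e' ∈ IsManifold.maximalAtlas I ∞ M) {y : EuclideanSpace ℝ (Fin n)}
    (hy : y ∈ (I.extendCoordChange e e').source) :
    (mfderivWithin 𝓘(ℝ, EuclideanSpace ℝ (Fin n)) I (e.extend I).symm (range I) y :
        EuclideanSpace ℝ (Fin n) →L[ℝ] EuclideanSpace ℝ (Fin n)) =
      ContinuousLinearMap.comp (mfderivWithin 𝓘(ℝ, EuclideanSpace ℝ (Fin n)) I (e'.extend I).symm
        (range I) (I.extendCoordChange e e' y) :
          EuclideanSpace ℝ (Fin n) →L[ℝ] EuclideanSpace ℝ (Fin n)) (coordChangeDeriv I e e' y) := by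
  set s := (I.extendCoordChange e e').source
  have hs : s ⊆ range I := by
    simp only [s, I.extendCoordChange_source]
    exact image_subset_range _ _
  have h1 := (hasMFDerivWithinAt_extend_symm he (mem_extendCoordChange_source.1 hy).1).mono hs
  have hy' : I.extendCoordChange e e' y ∈ (e'.extend I).target := by
    have := (I.extendCoordChange e e').map_source hy
    rw [← PartialEquiv.symm_source, I.extendCoordChange_symm] at this
    exact (mem_extendCoordChange_source.1 this).1
  have h2 := hasMFDerivWithinAt_extend_symm he' hy'
  have h3 := (hasFDerivWithinAt_extendCoordChange he he' hy).hasMFDerivWithinAt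
  have h4 := h2.comp y h3 (fun z hz => by
    have := (I.extendCoordChange e e').map_source hz
    rw [I.extendCoordChange_target] at this
    exact image_subset_range _ _ this)
  have h5 := h4.congr_mono (f₁ := (e.extend I).symm) (t := s)
    (fun z hz => (extend_symm_extendCoordChange hz).symm)
    (extend_symm_extendCoordChange hy).symm subset_rfl
  exact (I.uniqueDiffOn_extendCoordChange_source (e := e) (e' := e') y hy).uniqueMDiffWithinAt.eq
    h1 h5

/-- The components of a family of top degree forms in two charts differ by the Jacobian determinant
of the coordinate change. -/
theorem apply_chartFrame_eq (he : e ∈ IsManifold.maximalAtlas I ∞ M)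
    (he' : e' ∈ IsManifold.maximalAtlas I ∞ M) {y : EuclideanSpace ℝ (Fin n)}
    (hy : y ∈ (I.extendCoordChange e e').source)
    (A : ∀ p : M, (TangentSpace I p) [⋀^Fin n]→ₗ[ℝ] ℝ) :
    A ((e.extend I).symm y) (chartFrame e y) = (coordChangeDeriv I e e' y).det *
      A ((e'.extend I).symm (I.extendCoordChange e e' y))
        (chartFrame e' (I.extendCoordChange e e' y)) := by
  -- Tangent spaces unfold to the model space; this non-dependent typing allows the base point to be
  -- rewritten.
  let A' : M → EuclideanSpace ℝ (Fin n) [⋀^Fin n]→ₗ[ℝ] ℝ := A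
  let L' : EuclideanSpace ℝ (Fin n) →L[ℝ] EuclideanSpace ℝ (Fin n) :=
    mfderivWithin 𝓘(ℝ, EuclideanSpace ℝ (Fin n)) I (e'.extend I).symm
        (range I) (I.extendCoordChange e e' y)
  let b := (EuclideanSpace.basisFun (Fin n) ℝ).toBasis
  have hb : ⇑b = fun i => EuclideanSpace.single i (1 : ℝ) := by ext1 i; simp [b]
  have hframe : (chartFrame (I := I) e y : Fin n → EuclideanSpace ℝ (Fin n)) =
      fun i => L' (coordChangeDeriv I e e' y (b i)) := by
    ext1 i
    have := congrArg (fun L : EuclideanSpace ℝ (Fin n) →L[ℝ] EuclideanSpace ℝ (Fin n) =>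
      L (EuclideanSpace.single i (1 : ℝ))) (mfderivWithin_extend_symm_eq_comp he he' hy)
    rw [hb]
    exact this
  have hframe' : (chartFrame (I := I) e' (I.extendCoordChange e e' y) :
      Fin n → EuclideanSpace ℝ (Fin n)) = fun i => L' (b i) := by
    rw [hb]; rfl
  change A' ((e.extend I).symm y) (chartFrame (I := I) e y : Fin n → EuclideanSpace ℝ (Fin n)) = _ *
    A' ((e'.extend I).symm (I.extendCoordChange e e' y)) (chartFrame (I := I) e'
      (I.extendCoordChange e e' y) : Fin n → EuclideanSpace ℝ (Fin n))
  rw [hframe, hframe', extend_symm_extendCoordChange hy]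
  set B := (A' ((e.extend I).symm y)).compLinearMap L'.toLinearMap
  change B ((coordChangeDeriv I e e' y).toLinearMap ∘ b) = _ * B b
  -- A top degree alternating map is a multiple of the determinant in the basis `b`.
  rw [B.eq_smul_basis_det b, AlternatingMap.smul_apply, b.det_comp, b.det_self,
    AlternatingMap.smul_apply, b.det_self, smul_eq_mul, smul_eq_mul, mul_one, mul_one, mul_comm,
    ContinuousLinearMap.det]

/-- The component of a smooth top degree form in a chart is continuous. -/
theorem SmoothForm.continuousOn_valueAt_chartFrame [IsManifold I ∞ M] [T2Space M] (T : SmoothForm I M)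
    (he : e ∈ IsManifold.maximalAtlas I ∞ M) :
    ContinuousOn (fun y => T.valueAt ((e.extend I).symm y) (chartFrame e y))
      (e.extend I).target := by
  intro y₀ hy₀
  set p := (e.extend I).symm y₀ with hp
  let c := chartAt H p
  have hc : c ∈ IsManifold.maximalAtlas I ∞ M := IsManifold.chart_mem_maximalAtlas p
  let χ : SmoothBumpFunction I p := Classical.arbitrary _
  have hy₀s : y₀ ∈ (I.extendCoordChange e c).source :=
    mem_extendCoordChange_source.2 ⟨hy₀, mem_chart_source H p⟩
  have hsymm : ContinuousWithinAt (e.extend I).symm (e.extend I).target y₀ :=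
    e.continuousOn_extend_symm y₀ hy₀
  have hs : (I.extendCoordChange e c).source ∈ 𝓝[(e.extend I).target] y₀ :=
    nhdsWithin_mono _ e.extend_target_subset_range
      (I.extendCoordChange_source_mem_nhdsWithin hy₀s)
  -- Near `p` the cutoff is 1, so the fields `bumpFrame χ` restrict to the coordinate frame of `c`.
  -- The coefficient in `e` is therefore the Jacobian times the smooth function `T (bumpFrame χ)`.
  have hdet : ContinuousWithinAt (fun y => (coordChangeDeriv I e c y).det *
      T (bumpFrame χ) ((e.extend I).symm y)) (e.extend I).target y₀ := by
    refine ContinuousWithinAt.mul ?_ ?_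
    · exact (ContinuousLinearMap.continuous_det.continuousAt.comp_continuousWithinAt
        (continuousOn_coordChangeDeriv he hc y₀ hy₀s)).mono_of_mem_nhdsWithin hs
    · exact (T (bumpFrame χ)).contMDiff.continuous.continuousAt.comp_continuousWithinAt hsymm
  refine hdet.congr_of_eventuallyEq_of_mem ?_ hy₀
  filter_upwards [hs, hsymm.eventually χ.eventuallyEq_one] with y hy hχ
  rw [apply_chartFrame_eq he hc hy]
  congr 1
  rw [← T.valueAt_apply_field]
  have hcs : (e.extend I).symm y ∈ c.source := (mem_extendCoordChange_source.1 hy).2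
  have hbs : (e.extend I).symm y ∈
      (trivializationAt (EuclideanSpace ℝ (Fin n)) (TangentSpace I) p).baseSet := hcs
  have hfr : ∀ i, (bumpFrame χ i ((e.extend I).symm y) : EuclideanSpace ℝ (Fin n)) =
      chartFrame (I := I) c (I.extendCoordChange e c y) i := by
    intro i
    change (χ ((e.extend I).symm y) • (trivializationAt (EuclideanSpace ℝ (Fin n)) (TangentSpace I)
      p).localFrame (EuclideanSpace.basisFun (Fin n) ℝ).toBasis i ((e.extend I).symm y)) = _
    rw [hχ, Pi.one_apply, one_smul, Bundle.Trivialization.localFrame_apply_of_mem_baseSet _ _ hbs]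
    have := congrArg (fun L : EuclideanSpace ℝ (Fin n) →L[ℝ] EuclideanSpace ℝ (Fin n) =>
      L (EuclideanSpace.single i (1 : ℝ))) (TangentBundle.symmL_trivializationAt (I := I) hcs)
    refine Eq.trans (Eq.trans ?_ (Bundle.Trivialization.symmL_apply (R := ℝ) _ hbs _).symm) this
    rw [Bundle.Trivialization.basisAt, Module.Basis.map_apply, OrthonormalBasis.coe_toBasis, EuclideanSpace.basisFun_apply]
    rfl
  have hfr' : (fun i => bumpFrame χ i ((e.extend I).symm y) : Fin n → EuclideanSpace ℝ (Fin n)) =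
      chartFrame (I := I) c (I.extendCoordChange e c y) := funext hfr
  let A' : M → EuclideanSpace ℝ (Fin n) [⋀^Fin n]→ₗ[ℝ] ℝ := T.valueAt
  change A' _ (chartFrame (I := I) c (I.extendCoordChange e c y) : Fin n → EuclideanSpace ℝ (Fin n))
    = A' _ (fun i => bumpFrame χ i ((e.extend I).symm y) : Fin n → EuclideanSpace ℝ (Fin n))
  rw [hfr', extend_symm_extendCoordChange hy]

end CoordinateChange

/-! ### Pointwise values of vector-valued forms, and integrability in charts. -/

section Values

variable {n : ℕ} {H : Type*} [TopologicalSpace H]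
  {I : ModelWithCorners ℝ (EuclideanSpace ℝ (Fin n)) H}
  {M : Type*} [TopologicalSpace M] [ChartedSpace H M] [IsManifold I ∞ M] [T2Space M]
  {𝕜 : Type*} [RCLike 𝕜]
  {G : Type*} [AddCommGroup G] [Module 𝕜 G] [Module ℝ G] [IsScalarTower ℝ 𝕜 G]
  [TopologicalSpace G]

namespace IntegrableForm

theorem valueAt_smul (g : SmoothFun I M) (η : IntegrableForm 𝕜 I M G) (p : M) :
    valueAt (g • η) p = g p • valueAt η p := by
  induction η using TensorProduct.induction_on with
  | zero => rw [smul_zero, valueAt_zero, smul_zero]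
  | tmul f T =>
    ext v
    rw [TensorProduct.smul_tmul', valueAt_tmul, AlternatingMap.smul_apply, valueAt_tmul,
      smul_map_apply, smul_comm]
  | add η θ hη hθ => rw [smul_add, valueAt_add, valueAt_add, hη, hθ, smul_add]

theorem valueAt_push {G₁ : Type*} [AddCommGroup G₁] [Module 𝕜 G₁] [Module ℝ G₁]
    [IsScalarTower ℝ 𝕜 G₁] [TopologicalSpace G₁] (ψ : G →L[𝕜] G₁) (η : IntegrableForm 𝕜 I M G)
    (p : M) (v : Fin n → TangentSpace I p) : valueAt (push ψ η) p v = ψ (valueAt η p v) := by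
  induction η using TensorProduct.induction_on with
  | zero => simp [valueAt_zero]
  | tmul f T => exact ((ψ : G →ₗ[𝕜] G₁).map_smul_of_tower _ _).symm
  | add η θ hη hθ =>
    rw [map_add, valueAt_add, valueAt_add, AlternatingMap.add_apply, AlternatingMap.add_apply,
      map_add, hη, hθ]

theorem valueAt_re (β : IntegrableForm 𝕜 I M 𝕜) (p : M) (v : Fin n → TangentSpace I p) :
    valueAt (re β) p v = RCLike.re (valueAt β p v) := by
  induction β using TensorProduct.induction_on with
  | zero => simp [valueAt_zero]
  | tmul f T => exact ((RCLike.reCLM : 𝕜 →L[ℝ] ℝ).map_smul _ _).symm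
  | add η θ hη hθ =>
    rw [map_add, valueAt_add, valueAt_add, AlternatingMap.add_apply, AlternatingMap.add_apply,
      map_add, hη, hθ]

theorem valueAt_im (β : IntegrableForm 𝕜 I M 𝕜) (p : M) (v : Fin n → TangentSpace I p) :
    valueAt (im β) p v = RCLike.im (valueAt β p v) := by
  induction β using TensorProduct.induction_on with
  | zero => simp [valueAt_zero]
  | tmul f T => exact ((RCLike.imCLM : 𝕜 →L[ℝ] ℝ).map_smul _ _).symm
  | add η θ hη hθ =>
    rw [map_add, valueAt_add, valueAt_add, AlternatingMap.add_apply, AlternatingMap.add_apply,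
      map_add, hη, hθ]

theorem valueAt_eq_zero_of_notMem_support {η : IntegrableForm 𝕜 I M G} {p : M}
    (hp : p ∉ support η) : valueAt η p = 0 :=
  by_contra fun h => hp (subset_closure h)

theorem locallyIntegrableOn_valueAt_chartFrame (β : IntegrableForm ℝ I M ℝ)
    {e : OpenPartialHomeomorph M H} (he : e ∈ IsManifold.maximalAtlas I ∞ M) :
    LocallyIntegrableOn (fun y => valueAt β ((e.extend I).symm y) (chartFrame e y))
      (e.extend I).target volume := by
  induction β using TensorProduct.induction_on with
  | zero => exact locallyIntegrableOn_zero
  | tmul f T =>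
    exact (f.2.2 e he (ContinuousLinearMap.id ℝ ℝ)).continuousOn_smul
      (isLocallyClosed_extend_target e) (T.continuousOn_valueAt_chartFrame he)
  | add η θ hη hθ =>
    refine (hη.add hθ).congr (Filter.Eventually.of_forall fun y => ?_)
    change _ = valueAt (η + θ) _ _
    rw [valueAt_add]
    rfl

/-- The coefficient of `β` is only locally integrable on the chart image, but that of `g • β`
vanishes off the image of the compact set `tsupport g ∩ support β`. -/
theorem integrableOn_valueAt_smul_chartFrame (β : IntegrableForm ℝ I M ℝ)
    {e : OpenPartialHomeomorph M H} (he : e ∈ IsManifold.maximalAtlas I ∞ M) {g : SmoothFun I M}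
    (hg : tsupport g ⊆ e.source) :
    IntegrableOn (fun y => valueAt (g • β) ((e.extend I).symm y) (chartFrame e y))
      (e.extend I).target volume := by
  have hK : IsCompact (tsupport g ∩ support β) :=
    (isCompact_support β).inter_left (isClosed_tsupport _)
  have hKe : tsupport g ∩ support β ⊆ (e.extend I).source := by
    rw [e.extend_source]
    exact inter_subset_left.trans hg
  have hK' : IsCompact (e.extend I '' (tsupport g ∩ support β)) :=
    hK.image_of_continuousOn ((e.continuousOn_extend (I := I)).mono hKe)
  have hsub : e.extend I '' (tsupport g ∩ support β) ⊆ (e.extend I).target :=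
    ((e.extend I).mapsTo.mono_left hKe).image_subset
  refine ((locallyIntegrableOn_valueAt_chartFrame (g • β) he).integrableOn_compact_subset hsub
    hK').of_forall_sdiff_eq_zero (measurableSet_extend_target e) fun y hy => ?_
  have hy' : (e.extend I).symm y ∉ tsupport g ∩ support β := fun h =>
    hy.2 ⟨_, h, (e.extend I).right_inv hy.1⟩
  rw [valueAt_smul]
  rcases not_and_or.1 hy' with h | h
  · rw [image_eq_zero_of_notMem_tsupport h, zero_smul, AlternatingMap.zero_apply]
  · rw [valueAt_eq_zero_of_notMem_support h, smul_zero, AlternatingMap.zero_apply]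

end IntegrableForm

open IntegrableForm

theorem chartIntegral_eq_sum {ι : Type*} [Fintype ι] {e : OpenPartialHomeomorph M H}
    {β : IntegrableForm ℝ I M ℝ} {c : ι → ℝ} {θ : ι → IntegrableForm ℝ I M ℝ}
    (hθ : ∀ i, IntegrableOn (fun y => valueAt (θ i) ((e.extend I).symm y) (chartFrame e y))
      (e.extend I).target volume)
    (h : ∀ p v, valueAt β p v = ∑ i, c i * valueAt (θ i) p v) :
    chartIntegral e β = ∑ i, c i * chartIntegral e (θ i) := by
  unfold chartIntegral
  simp_rw [← integral_const_mul]
  rw [← integral_finsetSum _ fun i _ => (hθ i).const_mul (c i)]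
  refine integral_congr_ae (Filter.Eventually.of_forall fun y => ?_)
  exact h _ _

end Values

/-! ### Orientation signs and comparison of two oriented charts. -/

section Integral

variable {n : ℕ} {H : Type*} [TopologicalSpace H]
  {I : ModelWithCorners ℝ (EuclideanSpace ℝ (Fin n)) H}
  {M : Type*} [TopologicalSpace M] [ChartedSpace H M]

namespace ManifoldOrientation

theorem IsOrientedChart.exists_basis {o : ManifoldOrientation I M} {e : OpenPartialHomeomorph M H}
    (he : o.IsOrientedChart e) {y : EuclideanSpace ℝ (Fin n)} (hy : y ∈ (e.extend I).target) :
    ∃ b : Module.Basis (Fin n) ℝ (TangentSpace I ((e.extend I).symm y)), ⇑b = chartFrame e y ∧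
      (o.chartSign e = 1 ∧ b.orientation = o.orient ((e.extend I).symm y) ∨
        o.chartSign e = -1 ∧ b.orientation = -o.orient ((e.extend I).symm y)) := by
  by_cases hpos : o.IsPositive e
  · obtain ⟨b, hb, hbo⟩ := hpos y hy
    exact ⟨b, hb, Or.inl ⟨if_pos hpos, hbo⟩⟩
  · obtain ⟨b, hb, hbo⟩ := he.2.resolve_left hpos y hy
    exact ⟨b, hb, Or.inr ⟨if_neg hpos, hbo⟩⟩

/-- The sign of the Jacobian determinant of a change of oriented charts. -/
theorem chartSign_mul_det {o : ManifoldOrientation I M} {e e' : OpenPartialHomeomorph M H}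
    (he : o.IsOrientedChart e) (he' : o.IsOrientedChart e') {y : EuclideanSpace ℝ (Fin n)}
    (hy : y ∈ (I.extendCoordChange e e').source) :
    o.chartSign e * (coordChangeDeriv I e e' y).det =
      o.chartSign e' * |(coordChangeDeriv I e e' y).det| := by
  have hy' : I.extendCoordChange e e' y ∈ (e'.extend I).target := by
    have := (I.extendCoordChange e e').map_source hy
    rw [← PartialEquiv.symm_source, I.extendCoordChange_symm] at this
    exact (mem_extendCoordChange_source.1 this).1
  obtain ⟨b, hb, hbo⟩ := he.exists_basis (mem_extendCoordChange_source.1 hy).1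
  obtain ⟨b', hb', hbo'⟩ := he'.exists_basis hy'
  let O : M → Orientation ℝ (EuclideanSpace ℝ (Fin n)) (Fin n) := o.orient
  let c : Module.Basis (Fin n) ℝ (EuclideanSpace ℝ (Fin n)) := b
  let c' : Module.Basis (Fin n) ℝ (EuclideanSpace ℝ (Fin n)) := b'
  have hO : O ((e'.extend I).symm (I.extendCoordChange e e' y)) = O ((e.extend I).symm y) := by
    rw [extend_symm_extendCoordChange hy]
  have hdet : c'.det c = (coordChangeDeriv I e e' y).det := by
    -- Applied to the determinant of the second coordinate frame, the transformation law identifies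
    -- the Jacobian with the determinant of one frame in the other.
    have h := apply_chartFrame_eq he.1 he'.1 hy fun _ => c'.det
    rw [← hb, ← hb'] at h
    refine h.trans ?_
    have : c'.det c' = 1 := c'.det_self
    exact (congrArg _ this).trans (mul_one _)
  have hne := Module.Ray.ne_neg_self (O ((e.extend I).symm y))
  have hc : o.chartSign e = 1 ∧ c.orientation = O ((e.extend I).symm y) ∨
      o.chartSign e = -1 ∧ c.orientation = -O ((e.extend I).symm y) := hbo
  have hc' : o.chartSign e' = 1 ∧ c'.orientation = O ((e.extend I).symm y) ∨
      o.chartSign e' = -1 ∧ c'.orientation = -O ((e.extend I).symm y) := hO ▸ hbo'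
  have hiff := c'.orientation_eq_iff_det_pos c
  rw [hdet] at hiff
  rcases hc with ⟨hs, h⟩ | ⟨hs, h⟩ <;> rcases hc' with ⟨hs', h'⟩ | ⟨hs', h'⟩ <;>
    rw [hs, hs'] <;> rw [h, h'] at hiff
  · rw [abs_of_pos (hiff.1 rfl)]
  · rw [abs_of_nonpos (not_lt.1 fun hlt => hne (hiff.2 hlt).symm)]
    ring
  · rw [abs_of_nonpos (not_lt.1 fun hlt => hne (hiff.2 hlt))]
    ring
  · rw [abs_of_pos (hiff.1 rfl)]

theorem IsAdapted.sum_eq_one {o : ManifoldOrientation I M} {S : Set M} {D : Type*} [Fintype D]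
    {e : D → OpenPartialHomeomorph M H} {ρ : SmoothPartitionOfUnity (Option D) I M}
    (h : o.IsAdapted S e ρ) {p : M} (hp : p ∈ S) : ∑ α, ρ (some α) p = 1 := by
  have h1 := ρ.sum_eq_one (mem_univ p)
  have h0 : ρ none p = 0 := image_eq_zero_of_notMem_tsupport fun hn => h.subordinate none hn hp
  rwa [finsum_eq_sum_of_fintype, Fintype.sum_option, h0, zero_add] at h1

end ManifoldOrientation

open IntegrableForm ManifoldOrientation

variable [IsManifold I ∞ M] [T2Space M]

/-- The oriented integral of a form in an oriented chart containing its support does not depend on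
the chart. -/
theorem chartSign_mul_chartIntegral_eq {o : ManifoldOrientation I M}
    {e e' : OpenPartialHomeomorph M H} (he : o.IsOrientedChart e) (he' : o.IsOrientedChart e')
    {β : IntegrableForm ℝ I M ℝ} (hβ : ∀ p, p ∉ e.source ∩ e'.source → valueAt β p = 0) :
    o.chartSign e * chartIntegral e β = o.chartSign e' * chartIntegral e' β := by
  -- Both integrals live on the overlap, where the change of variables formula applies.
  have hrestrict : ∀ f f' : OpenPartialHomeomorph M H,
      (∀ p, p ∉ f.source ∩ f'.source → valueAt β p = 0) →
      chartIntegral f β = ∫ y in (I.extendCoordChange f f').source,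
        valueAt β ((f.extend I).symm y) (chartFrame f y) := by
    intro f f' hff'
    refine setIntegral_eq_of_subset_of_forall_sdiff_eq_zero (measurableSet_extend_target f)
      (fun y hy => (mem_extendCoordChange_source.1 hy).1) fun y hy => ?_
    rw [hff' _ fun h => hy.2 (mem_extendCoordChange_source.2 ⟨hy.1, h.2⟩),
      AlternatingMap.zero_apply]
  rw [hrestrict e e' hβ, hrestrict e' e fun p hp => hβ p fun h => hp h.symm,
    ← I.extendCoordChange_symm (e := e) (e' := e'),
    PartialEquiv.symm_source, ← PartialEquiv.image_source_eq_target,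
    integral_image_eq_integral_abs_det_fderiv_smul volume
      (measurableSet_extendCoordChange_source e e')
      (fun y hy => hasFDerivWithinAt_extendCoordChange he.1 he'.1 hy)
      (I.extendCoordChange e e').injOn, ← integral_const_mul, ← integral_const_mul]
  refine setIntegral_congr_fun (measurableSet_extendCoordChange_source e e') fun y hy => ?_
  change _ * valueAt β ((e.extend I).symm y) (chartFrame e y) = _
  rw [apply_chartFrame_eq he.1 he'.1 hy, ← mul_assoc, chartSign_mul_det he he' hy, mul_assoc,
    smul_eq_mul]

/-- The sum of the oriented chart integrals of the pieces of a form cut out by a partition of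
unity. -/
noncomputable def adaptedSum (o : ManifoldOrientation I M) {D : Type*} [Fintype D]
    (e : D → OpenPartialHomeomorph M H) (ρ : SmoothPartitionOfUnity (Option D) I M)
    (β : IntegrableForm ℝ I M ℝ) : ℝ :=
  ∑ α, o.chartSign (e α) * chartIntegral (e α) ((ρ (some α) : SmoothFun I M) • β)

/-! ### Independence of charts and partition, and linearity of the integral. -/

section Independence

variable {o : ManifoldOrientation I M} {S S' : Set M} {D D' : Type*} [Fintype D] [Fintype D']
  {e : D → OpenPartialHomeomorph M H} {ρ : SmoothPartitionOfUnity (Option D) I M}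
  {e' : D' → OpenPartialHomeomorph M H} {ρ' : SmoothPartitionOfUnity (Option D') I M}

theorem ManifoldOrientation.IsAdapted.valueAt_eq_sum {𝕜 : Type*} [RCLike 𝕜] {G : Type*}
    [AddCommGroup G] [Module 𝕜 G] [Module ℝ G] [IsScalarTower ℝ 𝕜 G] [TopologicalSpace G]
    (h : o.IsAdapted S e ρ) {η : IntegrableForm 𝕜 I M G} (hS : support η ⊆ S) (p : M)
    (v : Fin n → TangentSpace I p) :
    valueAt η p v = ∑ α, valueAt ((ρ (some α) : SmoothFun I M) • η) p v := by
  simp_rw [valueAt_smul, AlternatingMap.smul_apply, ← Finset.sum_smul]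
  by_cases hp : p ∈ S
  · rw [h.sum_eq_one hp, one_smul]
  · rw [valueAt_eq_zero_of_notMem_support fun h => hp (hS h), AlternatingMap.zero_apply, smul_zero]

theorem ManifoldOrientation.IsAdapted.chartIntegral_eq_sum (h : o.IsAdapted S e ρ)
    {β : IntegrableForm ℝ I M ℝ} (hS : support β ⊆ S) {f : OpenPartialHomeomorph M H}
    (hf : f ∈ IsManifold.maximalAtlas I ∞ M) {g : SmoothFun I M} (hg : tsupport g ⊆ f.source) :
    chartIntegral f (g • β) =
      ∑ α, chartIntegral f ((g * (ρ (some α) : SmoothFun I M)) • β) := by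
  rw [VectorForms.chartIntegral_eq_sum (c := fun _ => 1)
    (θ := fun α => (g * (ρ (some α) : SmoothFun I M)) • β)]
  · simp
  · exact fun α => integrableOn_valueAt_smul_chartFrame β hf
      ((tsupport_mul_subset_left (f := g)).trans hg)
  · intro p v
    simp_rw [one_mul, mul_smul, valueAt_smul g, AlternatingMap.smul_apply, ← Finset.smul_sum]
    rw [← h.valueAt_eq_sum hS]

/-- Cutting each piece again by the other partition turns both sides into double sums of the forms
`ρ_α ρ'_α' β`, each vanishing off the overlap of its two charts. -/
theorem ManifoldOrientation.IsAdapted.adaptedSum_eq (h : o.IsAdapted S e ρ)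
    (h' : o.IsAdapted S' e' ρ') {β : IntegrableForm ℝ I M ℝ} (hS : support β ⊆ S)
    (hS' : support β ⊆ S') : adaptedSum o e ρ β = adaptedSum o e' ρ' β := by
  unfold adaptedSum
  simp_rw [fun α => h'.chartIntegral_eq_sum hS' (h.oriented α).1 (h.subordinate (some α)),
    fun α => h.chartIntegral_eq_sum hS (h'.oriented α).1 (h'.subordinate (some α)),
    Finset.mul_sum]
  rw [Finset.sum_comm]
  refine Finset.sum_congr rfl fun α' _ => Finset.sum_congr rfl fun α _ => ?_
  rw [mul_comm (ρ' (some α') : SmoothFun I M)]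
  refine chartSign_mul_chartIntegral_eq (h.oriented α) (h'.oriented α') fun p hp => ?_
  rw [mul_smul, valueAt_smul, valueAt_smul]
  rcases not_and_or.1 hp with hp | hp
  · rw [image_eq_zero_of_notMem_tsupport fun h1 => hp (h.subordinate (some α) h1), zero_smul]
  · rw [image_eq_zero_of_notMem_tsupport (f := ρ' (some α'))
      fun h1 => hp (h'.subordinate (some α') h1), zero_smul, smul_zero]

variable [SecondCountableTopology M]

/-- The integral of a form may be computed from any adapted charts and partition of unity. -/
theorem ManifoldOrientation.IsAdapted.realIntegral_eq (h : o.IsAdapted S e ρ)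
    {β : IntegrableForm ℝ I M ℝ} (hS : support β ⊆ S) :
    realIntegral o β = adaptedSum o e ρ β :=
  (o.exists_isAdapted (isCompact_support β)).choose_spec.choose_spec.choose_spec.adaptedSum_eq h
    subset_rfl hS

/-- Data adapted to the union of all the supports compute every integral involved. The hypothesis
concerns values only, so no identity in the tensor product is needed. -/
theorem realIntegral_eq_sum {ι : Type*} [Fintype ι] {β : IntegrableForm ℝ I M ℝ} {c : ι → ℝ}
    {θ : ι → IntegrableForm ℝ I M ℝ} (h : ∀ p v, valueAt β p v = ∑ i, c i * valueAt (θ i) p v) :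
    realIntegral o β = ∑ i, c i * realIntegral o (θ i) := by
  obtain ⟨k, e, ρ, he⟩ := o.exists_isAdapted
    ((isCompact_support β).union (isCompact_iUnion fun i => isCompact_support (θ i)))
  rw [he.realIntegral_eq subset_union_left]
  simp_rw [fun i => he.realIntegral_eq (β := θ i)
    ((subset_iUnion (fun i => support (θ i)) i).trans subset_union_right)]
  unfold adaptedSum
  simp_rw [Finset.mul_sum]
  rw [Finset.sum_comm]
  refine Finset.sum_congr rfl fun α _ => ?_
  rw [VectorForms.chartIntegral_eq_sum (c := c)
    (θ := fun i => (ρ (some α) : SmoothFun I M) • θ i)]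
  · rw [Finset.mul_sum]
    exact Finset.sum_congr rfl fun i _ => mul_left_comm _ _ _
  · exact fun i => integrableOn_valueAt_smul_chartFrame (θ i) (he.oriented α).1
      (he.subordinate (some α))
  · intro p v
    simp_rw [valueAt_smul, AlternatingMap.smul_apply, h, Finset.smul_sum, smul_eq_mul]
    exact Finset.sum_congr rfl fun i _ => mul_left_comm _ _ _

theorem realIntegral_eq_add {β θ₁ θ₂ : IntegrableForm ℝ I M ℝ} {a b : ℝ}
    (h : ∀ p v, valueAt β p v = a * valueAt θ₁ p v + b * valueAt θ₂ p v) :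
    realIntegral o β = a * realIntegral o θ₁ + b * realIntegral o θ₂ := by
  rw [realIntegral_eq_sum (c := ![a, b]) (θ := ![θ₁, θ₂])]
  · simp
  · intro p v
    simp [h]

theorem scalarIntegral_eq_sum {𝕜 : Type*} [RCLike 𝕜] {ι : Type*} [Fintype ι]
    {β : IntegrableForm 𝕜 I M 𝕜} {θ : ι → IntegrableForm 𝕜 I M 𝕜}
    (h : ∀ p v, valueAt β p v = ∑ i, valueAt (θ i) p v) :
    scalarIntegral o β = ∑ i, scalarIntegral o (θ i) := by
  unfold scalarIntegral
  rw [realIntegral_eq_sum (c := fun _ => 1) (θ := fun i => re (θ i)),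
    realIntegral_eq_sum (c := fun _ => 1) (θ := fun i => im (θ i))]
  · simp [Finset.sum_add_distrib, Finset.mul_sum]
  · intro p v
    simp [valueAt_im, h]
  · intro p v
    simp [valueAt_re, h]

theorem scalarIntegral_eq_smul {𝕜 : Type*} [RCLike 𝕜] {β θ : IntegrableForm 𝕜 I M 𝕜} {c : 𝕜}
    (h : ∀ p v, valueAt β p v = c * valueAt θ p v) :
    scalarIntegral o β = c * scalarIntegral o θ := by
  unfold scalarIntegral
  rw [realIntegral_eq_add (β := re β) (a := RCLike.re c) (b := -RCLike.im c) (θ₁ := re θ) (θ₂ := im θ),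
    realIntegral_eq_add (β := im β) (a := RCLike.re c) (b := RCLike.im c) (θ₁ := im θ) (θ₂ := re θ)]
  · have hI := RCLike.I_mul_I_ax (K := 𝕜)
    have hc := RCLike.re_add_im c
    push_cast
    -- For `𝕜 = ℝ` one has `I = 0`, and the imaginary part of `c` vanishes; otherwise `I * I = -1`.
    rcases hI with hI | hI
    · have him : (RCLike.im c : 𝕜) = 0 := by simp [RCLike.im_eq_zero hI]
      linear_combination (realIntegral o (re θ) : 𝕜) * hc
        - ((realIntegral o (im θ) : 𝕜) + RCLike.I * (realIntegral o (re θ) : 𝕜)) * him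
        + ((RCLike.re c : 𝕜) * (realIntegral o (im θ) : 𝕜)
          + (RCLike.im c : 𝕜) * (realIntegral o (re θ) : 𝕜)
          - c * (realIntegral o (im θ) : 𝕜)) * hI
    · linear_combination ((realIntegral o (re θ) : 𝕜) + RCLike.I * (realIntegral o (im θ) : 𝕜)) * hc
        - (RCLike.im c : 𝕜) * (realIntegral o (im θ) : 𝕜) * hI
  · intro p v
    rw [valueAt_im β, valueAt_im, valueAt_re, h, RCLike.mul_im]
  · intro p v
    rw [valueAt_re β, valueAt_im, valueAt_re, h, RCLike.mul_re]
    ring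

end Independence

end Integral

end VectorForms

theorem mainTheorem9
    {n : ℕ} [NeZero n] {H : Type*} [TopologicalSpace H]
    {I : ModelWithCorners ℝ (EuclideanSpace ℝ (Fin n)) H}
    {M : Type*} [TopologicalSpace M] [ChartedSpace H M] [IsManifold I ∞ M]
    [T2Space M] [SecondCountableTopology M]
    {𝕜 : Type*} [RCLike 𝕜]
    {G : Type*} [AddCommGroup G] [Module 𝕜 G] [Module ℝ G] [IsScalarTower ℝ 𝕜 G]
    [TopologicalSpace G] [IsTopologicalAddGroup G] [ContinuousSMul 𝕜 G] [T2Space G]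
    [LocallyConvexSpace ℝ G]
    (o : VectorForms.ManifoldOrientation I M)
    (η : VectorForms.IntegrableForm 𝕜 I M G)
    {D : Type*} [Fintype D] (e : D → OpenPartialHomeomorph M H)
    (ρ : SmoothPartitionOfUnity (Option D) I M)
    (h : o.IsAdapted (VectorForms.IntegrableForm.support η) e ρ) :
    IsLinearMap 𝕜 (VectorForms.weakIntegral o η) ∧
      VectorForms.weakIntegral o η =
        ∑ α, VectorForms.weakIntegral o ((ρ (some α) : VectorForms.SmoothFun I M) • η) := by
  refine ⟨⟨fun ψ χ => ?_, fun c ψ => ?_⟩, funext fun ψ => ?_⟩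
  · unfold VectorForms.weakIntegral
    rw [VectorForms.scalarIntegral_eq_sum (θ := fun i : Fin 2 =>
      VectorForms.IntegrableForm.push (![ψ, χ] i) η), Fin.sum_univ_two]
    · rfl
    · intro p v
      simp [VectorForms.IntegrableForm.valueAt_push]
  · refine VectorForms.scalarIntegral_eq_smul fun p v => ?_
    simp [VectorForms.IntegrableForm.valueAt_push]
  · rw [Finset.sum_apply]
    refine VectorForms.scalarIntegral_eq_sum fun p v => ?_
    simp_rw [VectorForms.IntegrableForm.valueAt_push]
    -- The function `ρ none` vanishes on `supp η`, so the remaining ones recover `η` pointwise.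
    rw [h.valueAt_eq_sum subset_rfl, map_sum]
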